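/- Let $\{(b_k,e_k)\}_{k\ge 0}$ be independent, identically distributed random vectors in $\mathbb R^2$ with $E b_0=0$, $E b_0^2=\omega^2>0$, $E e_0=0$, $E e_0^2=\sigma^2>0$, $\mathrm{cov}(b_0,e_0)=0$, $E b_0^4<\infty$ and $E e_0^4<\infty$. Let $\varphi\in\mathbb R$, let $X_0\in\mathbb R$ be a constant, and let $X_k=(\varphi+b_k)X_{k-1}+e_k$ for $k\ge 1$. Assume that $$E\log|\varphi+b_0|>0$$ (with $\log 0=-\infty$; in particular $\varphi+b_0\ne 0$ a.s.), and that at least one of the following two conditions holds: (a) $P\{(\varphi+b_0)X_0+e_0=c\}=0$ for all $c\in\mathbb R$; (b) the sequences $\{b_k\}$ and $\{e_k\}$ are independent, and $P\{e_0=c\}<1$ for all $c\in\mathbb R$. Let $\Gamma=\{(s,x): s_*\le s\le s^*,\ x_*\le x\le x^*\}$, where $0<x_*$, $s_*<\varphi<s^*$ and $x_*<\omega^2<x^*$. For $y>0$ put $$L_n(s,x,y)=\sum_{k=1}^n-\frac12\left(\log(xX_{k-1}^2+y)+\frac{(X_k-sX_{k-1})^2}{xX_{k-1}^2+y}\right),$$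 and let $\widehat{\boldsymbol\eta}_n(y)$ be any (measurable) quasi-maximum likelihood estimator, i.e. a random vector in $\Gamma$ with $L_n(\widehat{\boldsymbol\eta}_n(y),y)=\max_{\mathbf z\in\Gamma}L_n(\mathbf z,y)$ almost surely. Then the matrix $$\Omega_0=\begin{pmatrix}\omega^2 & E b_0^3\\ E b_0^3 & \mathrm{var}(b_0^2)\end{pmatrix}$$ is positive semidefinite, and for every $y>0$ (not only for $y=\sigma^2$), as $n\to\infty$, the distribution of $n^{1/2}\bigl(\widehat{\boldsymbol\eta}_n(y)-(\varphi,\omega^2)\bigr)$ converges weakly to the bivariate normal distribution (possibly degenerate) with mean $\mathbf 0$ and covariance matrix $\Omega_0$. -/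

import Mathlib

open MeasureTheory ProbabilityTheory Filter

noncomputable section

/-- The random coefficient autoregression `X₀ = x₀`, `X_k = (φ + b_k) X_{k-1} + e_k` for `k ≥ 1`,
driven by given sequences `b`, `e` (the values `b 0`, `e 0` are not used). -/
def rcaPath (φ x₀ : ℝ) (b e : ℕ → ℝ) : ℕ → ℝ
  | 0 => x₀
  | k + 1 => (φ + b (k + 1)) * rcaPath φ x₀ b e k + e (k + 1)

/-- The Gaussian quasi-log-likelihood
`L_n(s, x, y) = ∑_{k=1}^n -1/2 (log (x X_{k-1}² + y) + (X_k - s X_{k-1})² / (x X_{k-1}² + y))`;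
the summation index below is `k - 1`. -/
def quasiLogLik (X : ℕ → ℝ) (n : ℕ) (s x y : ℝ) : ℝ :=
  ∑ k ∈ Finset.range n,
    -(1 / 2) * (Real.log (x * X k ^ 2 + y) + (X (k + 1) - s * X k) ^ 2 / (x * X k ^ 2 + y))

/-- The parameter rectangle `{(s, x) : sLo ≤ s ≤ sHi, xLo ≤ x ≤ xHi}`. -/
def paramRect (sLo sHi xLo xHi : ℝ) : Set (EuclideanSpace ℝ (Fin 2)) :=
  {z | (sLo ≤ z 0 ∧ z 0 ≤ sHi) ∧ (xLo ≤ z 1 ∧ z 1 ≤ xHi)}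

/-- `z` is a point of `Γ` at which `z ↦ L_n(z, y)` attains its maximum over `Γ`. -/
def IsQMLE (X : ℕ → ℝ) (n : ℕ) (y : ℝ) (Γ : Set (EuclideanSpace ℝ (Fin 2)))
    (z : EuclideanSpace ℝ (Fin 2)) : Prop :=
  z ∈ Γ ∧ IsMaxOn (fun u : EuclideanSpace ℝ (Fin 2) => quasiLogLik X n (u 0) (u 1) y) Γ z

/-- The limiting covariance matrix, with rows `(E B², E B³)` and `(E B³, Var (B²))`. -/
def limitCov {Ω : Type*} [MeasurableSpace Ω] (P : Measure Ω) (B : Ω → ℝ) :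
    Matrix (Fin 2) (Fin 2) ℝ :=
  !![∫ a, B a ^ 2 ∂P, ∫ a, B a ^ 3 ∂P; ∫ a, B a ^ 3 ∂P, variance (fun a => B a ^ 2) P]

end

open Topology

/-! Since `E log|φ + b_0| > 0`, the path explodes exponentially. Dividing the `k`-th likelihood
summand through by `X_{k-1}²` turns it, up to a parameter-free term, into the Gaussian criterion at
the ratio `X_k / X_{k-1} = φ + b_k + e_k / X_{k-1}` with variance `x + y / X_{k-1}²`. Both
perturbations `e_k / X_{k-1}` and `y / X_{k-1}²` are summably small, so the quasi-likelihood differs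
from the i.i.d. Gaussian likelihood of the unobserved `φ + b_k` by a function of the parameters
whose Lipschitz constant is bounded in `n` (`exists_summable_lipschitz`). The Gaussian likelihood
has its maximum at the empirical mean and variance with a quadratic drop of order `n`, so the
estimator lies within `O(1/n)` of them almost surely, whatever `y` is (`isQMLE_close`). The limit
law is then that of the empirical mean and variance of `b`: the CLT for `(b, b²)` plus Slutsky.

Exponential growth needs `X_n / ∏ (φ + b_k)` to have a nonzero limit. `infinitePi_negligibleOrbit`
proves this by a maximum principle for the probability, as a function of the starting point, that
the normalized orbit tends to zero. Its only obstructions are a common fixed point, excluded by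
`not_ae_common_fixed_point`, and almost surely non-expansive maps, excluded by the positive
log-moment. -/

/-! ### Perturbation and Lipschitz estimates for the one-step criterion -/

/-- The single-observation criterion `log (x + u) + (q - s)² / (x + u)`. -/
noncomputable def gaussLoss (s x q u : ℝ) : ℝ := Real.log (x + u) + (q - s) ^ 2 / (x + u)

/-- Factor `X²` out of the conditional variance. The term `log (X²)` is free of the parameters and
cancels in differences, and `y` survives only through the small quantity `y / X²`. -/
lemma quasiLogLik_term {X X' s x y : ℝ} (hX : X ≠ 0) (hx : 0 < x) (hy : 0 < y) :
    Real.log (x * X ^ 2 + y) + (X' - s * X) ^ 2 / (x * X ^ 2 + y) =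
      Real.log (X ^ 2) + gaussLoss s x (X' / X) (y / X ^ 2) := by
  have h1 : 0 < X ^ 2 := by positivity
  have h2 : 0 < x + y / X ^ 2 := by positivity
  have h3 : x * X ^ 2 + y = X ^ 2 * (x + y / X ^ 2) := by field_simp
  rw [gaussLoss, h3, Real.log_mul h1.ne' h2.ne']
  have : (X' - s * X) ^ 2 = X ^ 2 * (X' / X - s) ^ 2 := by field_simp
  rw [this, mul_div_mul_left _ _ h1.ne']
  ring

lemma log_sub_log_le {x x' : ℝ} (hx : 0 < x) (hx' : 0 < x') :
    Real.log x - Real.log x' ≤ (x - x') / x' := by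
  rw [← Real.log_div hx.ne' hx'.ne']
  have := Real.log_le_sub_one_of_pos (div_pos hx hx')
  have e : (x - x') / x' = x / x' - 1 := by field_simp
  rw [e]; exact this

lemma abs_log_sub_log_le {lo x x' : ℝ} (hlo : 0 < lo) (hx : lo ≤ x) (hx' : lo ≤ x') :
    |Real.log x - Real.log x'| ≤ |x - x'| / lo := by
  have hx0 : 0 < x := by linarith
  have hx0' : 0 < x' := by linarith
  have key : ∀ {a c : ℝ}, lo ≤ a → lo ≤ c → Real.log a - Real.log c ≤ |a - c| / lo := by
    intro a c ha hc
    refine (log_sub_log_le (by linarith) (by linarith)).trans ?_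
    calc (a - c) / c ≤ |a - c| / c := by gcongr <;> first | exact le_abs_self _ | linarith
      _ ≤ |a - c| / lo := by gcongr
  rw [abs_le]
  refine ⟨?_, key hx hx'⟩
  have := key hx' hx
  rw [abs_sub_comm] at this
  linarith

lemma log_perturb_le {lo x x' u : ℝ} (hlo : 0 < lo) (hx : lo ≤ x) (hx' : lo ≤ x') (hu : 0 ≤ u) :
    |(Real.log (x + u) - Real.log (x' + u)) - (Real.log x - Real.log x')| ≤
      u / lo ^ 2 * |x - x'| := by
  have key : ∀ {a c : ℝ}, lo ≤ a → lo ≤ c →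
      (Real.log (a + u) - Real.log (c + u)) - (Real.log a - Real.log c) ≤
        u / lo ^ 2 * |a - c| := by
    intro a c ha hc
    have ha0 : 0 < a := by linarith
    have hc0 : 0 < c := by linarith
    -- Grouping the four logarithms into two makes the arguments differ by `u * (c - a)`, so both
    -- small factors survive in the bound.
    have e : (Real.log (a + u) - Real.log (c + u)) - (Real.log a - Real.log c) =
        Real.log ((a + u) * c) - Real.log ((c + u) * a) := by
      rw [Real.log_mul (by positivity) hc0.ne', Real.log_mul (by positivity) ha0.ne']
      ring
    rw [e]
    refine (log_sub_log_le (by positivity) (by positivity)).trans ?_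
    have e2 : (a + u) * c - (c + u) * a = u * (c - a) := by ring
    rw [e2]
    calc u * (c - a) / ((c + u) * a) ≤ u * |a - c| / ((c + u) * a) := by
          gcongr
          rw [abs_sub_comm]
          exact le_abs_self _
      _ ≤ u * |a - c| / (lo * lo) := by
          gcongr
          linarith
      _ = u / lo ^ 2 * |a - c| := by ring
  rw [abs_le]
  refine ⟨?_, key hx hx'⟩
  have := key hx' hx
  rw [abs_sub_comm] at this
  linarith

lemma abs_inv_sub_inv_le {lo x x' : ℝ} (hlo : 0 < lo) (hx : lo ≤ x) (hx' : lo ≤ x') :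
    |x⁻¹ - x'⁻¹| ≤ |x - x'| / lo ^ 2 := by
  have hx0 : 0 < x := by linarith
  have hx0' : 0 < x' := by linarith
  rw [inv_sub_inv hx0.ne' hx0'.ne', abs_div, abs_sub_comm, abs_of_pos (mul_pos hx0 hx0'), sq]
  gcongr

lemma abs_mul_sub_mul_le (a a' p p' : ℝ) :
    |a * p - a' * p'| ≤ |a - a'| * |p| + |a'| * |p - p'| := by
  have : a * p - a' * p' = (a - a') * p + a' * (p - p') := by ring
  rw [this, ← abs_mul, ← abs_mul]
  exact abs_add_le _ _

lemma abs_inv_le {lo x : ℝ} (hlo : 0 < lo) (hx : lo ≤ x) : |x⁻¹| ≤ 1 / lo := by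
  rw [abs_inv, abs_of_pos (by linarith : 0 < x), one_div]
  gcongr

/-- Serves the indices with `X k = 0`, where the bound cannot be small but only has to be finite. -/
lemma gaussLoss_lipschitz {lo S s s' x x' r : ℝ} (hlo : 0 < lo) (hx : lo ≤ x) (hx' : lo ≤ x')
    (hs : |s| ≤ S) (hs' : |s'| ≤ S) :
    |gaussLoss s x r 0 - gaussLoss s' x' r 0| ≤
      (1 / lo + 2 * (|r| + S) / lo + (|r| + S) ^ 2 / lo ^ 2) * (|s - s'| + |x - x'|) := by
  have h1 := abs_log_sub_log_le hlo hx hx'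
  have h2 := abs_mul_sub_mul_le ((r - s) ^ 2) ((r - s') ^ 2) x⁻¹ x'⁻¹
  have h3 := abs_inv_sub_inv_le hlo hx hx'
  have h4 := abs_inv_le hlo hx
  have hS : 0 ≤ S := (abs_nonneg _).trans hs
  have hr := abs_nonneg r
  have h5 : |r - s| ≤ |r| + S := (abs_sub _ _).trans (by linarith)
  have h6 : |r - s'| ≤ |r| + S := (abs_sub _ _).trans (by linarith)
  have h7 : |(r - s) ^ 2 - (r - s') ^ 2| ≤ 2 * (|r| + S) * |s - s'| := by
    have e : (r - s) ^ 2 - (r - s') ^ 2 = ((r - s) + (r - s')) * (s' - s) := by ring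
    rw [e, abs_mul, abs_sub_comm s' s]
    gcongr
    exact (abs_add_le _ _).trans (by linarith)
  have h8 : |(r - s') ^ 2| ≤ (|r| + S) ^ 2 := by
    rw [abs_pow]
    gcongr
  have e : gaussLoss s x r 0 - gaussLoss s' x' r 0 =
      (Real.log x - Real.log x') + ((r - s) ^ 2 * x⁻¹ - (r - s') ^ 2 * x'⁻¹) := by
    simp only [gaussLoss, add_zero]
    ring
  rw [e]
  calc _ ≤ |x - x'| / lo + (2 * (|r| + S) * |s - s'| * (1 / lo) +
        (|r| + S) ^ 2 * (|x - x'| / lo ^ 2)) := by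
        refine (abs_add_le _ _).trans (add_le_add h1 (h2.trans ?_))
        gcongr
    _ ≤ _ := by
        have := abs_nonneg (s - s')
        have := abs_nonneg (x - x')
        have e : (1 / lo + 2 * (|r| + S) / lo + (|r| + S) ^ 2 / lo ^ 2) * (|s - s'| + |x - x'|) -
          (|x - x'| / lo + (2 * (|r| + S) * |s - s'| * (1 / lo) +
            (|r| + S) ^ 2 * (|x - x'| / lo ^ 2))) =
          |s - s'| / lo + 2 * (|r| + S) / lo * |x - x'| + (|r| + S) ^ 2 / lo ^ 2 * |s - s'| := by
          ring
        have : 0 ≤ |s - s'| / lo + 2 * (|r| + S) / lo * |x - x'| +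
          (|r| + S) ^ 2 / lo ^ 2 * |s - s'| := by positivity
        linarith

/-- Controls the cofactor of `q - r` in `(q - s)² - (r - s)² = (q - r)(q + r - 2s)`, divided by the
variance. -/
lemma mul_inv_lipschitz {lo S s s' x x' q r : ℝ} (hlo : 0 < lo) (hS : 0 ≤ S) (hx : lo ≤ x)
    (hx' : lo ≤ x') (hs' : |s'| ≤ S) :
    |(q + r - 2 * s) * x⁻¹ - (q + r - 2 * s') * x'⁻¹| ≤
      (2 / lo + (1 + 2 * S) / lo ^ 2) * (|q| + |r| + 1) * (|s - s'| + |x - x'|) := by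
  have hds := abs_nonneg (s - s')
  have hdx := abs_nonneg (x - x')
  have hinv := abs_inv_sub_inv_le hlo hx hx'
  have hi := abs_inv_le hlo hx
  have hq := abs_nonneg q
  have hr := abs_nonneg r
  refine (abs_mul_sub_mul_le _ _ _ _).trans ?_
  have e1 : |(q + r - 2 * s) - (q + r - 2 * s')| = 2 * |s - s'| := by
    rw [show (q + r - 2 * s) - (q + r - 2 * s') = (-2) * (s - s') by ring, abs_mul]
    simp
  have e2 : |q + r - 2 * s'| ≤ (1 + 2 * S) * (|q| + |r| + 1) := by
    refine (abs_sub _ _).trans ?_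
    rw [abs_mul, abs_two]
    have := abs_add_le q r
    nlinarith [mul_nonneg hS hq, mul_nonneg hS hr]
  rw [e1]
  set T := |q| + |r| + 1
  have hT : 1 ≤ T := by linarith
  calc 2 * |s - s'| * |x⁻¹| + |q + r - 2 * s'| * |x⁻¹ - x'⁻¹|
      ≤ 2 * |s - s'| * (1 / lo) * T + (1 + 2 * S) * T * (|x - x'| / lo ^ 2) := by
        refine add_le_add ?_ (by gcongr)
        refine le_trans ?_ (le_mul_of_one_le_right (by positivity) hT)
        gcongr
    _ = T * (2 / lo * |s - s'| + (1 + 2 * S) / lo ^ 2 * |x - x'|) := by ring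
    _ ≤ T * ((2 / lo + (1 + 2 * S) / lo ^ 2) * |s - s'| +
          (2 / lo + (1 + 2 * S) / lo ^ 2) * |x - x'|) := by
        have h1 : 0 ≤ 2 / lo := by positivity
        have h2 : 0 ≤ (1 + 2 * S) / lo ^ 2 := by positivity
        gcongr <;> linarith
    _ = _ := by ring

/-- Controls the cofactor of `-u` in `(r - s)² ((x + u)⁻¹ - x⁻¹)`. -/
lemma sq_mul_inv_mul_inv_lipschitz {lo S s s' x x' r u : ℝ} (hlo : 0 < lo) (hS : 0 ≤ S)
    (hx : lo ≤ x) (hx' : lo ≤ x') (hs : |s| ≤ S) (hs' : |s'| ≤ S) (hu : 0 ≤ u) :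
    |(r - s) ^ 2 * (x⁻¹ * (x + u)⁻¹) - (r - s') ^ 2 * (x'⁻¹ * (x' + u)⁻¹)| ≤
      (2 * (1 + S) / lo ^ 2 + 4 * (1 + S) ^ 2 / lo ^ 3) * (1 + r ^ 2) *
        (|s - s'| + |x - x'|) := by
  have hxu : lo ≤ x + u := by linarith
  have hxu' : lo ≤ x' + u := by linarith
  have hds := abs_nonneg (s - s')
  have hdx := abs_nonneg (x - x')
  have hinv : |(x + u)⁻¹ - (x' + u)⁻¹| ≤ |x - x'| / lo ^ 2 := by
    simpa using abs_inv_sub_inv_le hlo hxu hxu'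
  have hiu := abs_inv_le hlo hxu
  have hi := abs_inv_le hlo hx
  have hi' := abs_inv_le hlo hx'
  have h1 := sq_abs r
  have h0 := sq_nonneg r
  have hr0 := abs_nonneg r
  have hr2 : (|r| + S) ≤ (1 + S) * (1 + r ^ 2) := by
    have : |r| ≤ 1 + r ^ 2 := by nlinarith [sq_nonneg (|r| - 1)]
    have := mul_nonneg hS h0
    linarith
  have hr3 : (|r| + S) ^ 2 ≤ 2 * (1 + S) ^ 2 * (1 + r ^ 2) := by
    have h2 : (|r| + S) ^ 2 ≤ 2 * (r ^ 2 + S ^ 2) := by nlinarith [sq_nonneg (|r| - S)]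
    have h3 := mul_nonneg hS h0
    have h4 := mul_nonneg (sq_nonneg S) h0
    linarith
  refine (abs_mul_sub_mul_le _ _ _ _).trans ?_
  have h5 : |r - s| ≤ |r| + S := (abs_sub _ _).trans (by linarith)
  have h6 : |r - s'| ≤ |r| + S := (abs_sub _ _).trans (by linarith)
  have h7 : |(r - s) ^ 2 - (r - s') ^ 2| ≤ 2 * ((1 + S) * (1 + r ^ 2)) * |s - s'| := by
    have e : (r - s) ^ 2 - (r - s') ^ 2 = ((r - s) + (r - s')) * (s' - s) := by ring
    rw [e, abs_mul, abs_sub_comm s' s]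
    gcongr
    exact (abs_add_le _ _).trans (by linarith)
  have h8 : |(r - s') ^ 2| ≤ 2 * (1 + S) ^ 2 * (1 + r ^ 2) := by
    rw [abs_pow]
    exact le_trans (by gcongr) hr3
  have h9 : |x⁻¹ * (x + u)⁻¹| ≤ 1 / lo * (1 / lo) := by
    rw [abs_mul]
    gcongr
  have h10 : |x⁻¹ * (x + u)⁻¹ - x'⁻¹ * (x' + u)⁻¹| ≤
      |x - x'| / lo ^ 2 * (1 / lo) + 1 / lo * (|x - x'| / lo ^ 2) := by
    refine (abs_mul_sub_mul_le _ _ _ _).trans ?_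
    have := abs_inv_sub_inv_le hlo hx hx'
    gcongr
  set T := 1 + r ^ 2
  calc _ ≤ 2 * ((1 + S) * T) * |s - s'| * (1 / lo * (1 / lo)) +
        2 * (1 + S) ^ 2 * T * (|x - x'| / lo ^ 2 * (1 / lo) + 1 / lo * (|x - x'| / lo ^ 2)) := by
        gcongr
    _ = T * (2 * (1 + S) / lo ^ 2 * |s - s'| + 4 * (1 + S) ^ 2 / lo ^ 3 * |x - x'|) := by ring
    _ ≤ T * ((2 * (1 + S) / lo ^ 2 + 4 * (1 + S) ^ 2 / lo ^ 3) * |s - s'| +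
          (2 * (1 + S) / lo ^ 2 + 4 * (1 + S) ^ 2 / lo ^ 3) * |x - x'|) := by
        have h1 : 0 ≤ 2 * (1 + S) / lo ^ 2 := by positivity
        have h2 : 0 ≤ 4 * (1 + S) ^ 2 / lo ^ 3 := by positivity
        gcongr <;> linarith
    _ = _ := by ring

/-- The perturbation of the criterion is Lipschitz in the parameters, with a constant that
vanishes with the size of the perturbation. -/
lemma gaussLoss_perturb {lo S : ℝ} (hlo : 0 < lo) :
    ∃ C : ℝ, 0 ≤ C ∧ ∀ {s s' x x' q r u : ℝ}, lo ≤ x → lo ≤ x' → |s| ≤ S → |s'| ≤ S → 0 ≤ u →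
      |(gaussLoss s x q u - gaussLoss s' x' q u) - (gaussLoss s x r 0 - gaussLoss s' x' r 0)| ≤
        C * (|q - r| * (|q| + |r| + 1) + u * (1 + r ^ 2)) * (|s - s'| + |x - x'|) := by
  by_cases hS : 0 ≤ S
  swap
  · exact ⟨0, le_rfl, fun {s} _ _ _ _ _ _ _ _ hs => absurd ((abs_nonneg s).trans hs) hS⟩
  have hA : 0 ≤ 2 / lo + (1 + 2 * S) / lo ^ 2 := by positivity
  have hB : 0 ≤ 2 * (1 + S) / lo ^ 2 + 4 * (1 + S) ^ 2 / lo ^ 3 := by positivity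
  have hE : 0 ≤ 1 / lo ^ 2 := by positivity
  refine ⟨(2 / lo + (1 + 2 * S) / lo ^ 2) +
    ((2 * (1 + S) / lo ^ 2 + 4 * (1 + S) ^ 2 / lo ^ 3) + 1 / lo ^ 2), by positivity, ?_⟩
  intro s s' x x' q r u hx hx' hs hs' hu
  have hx0 : 0 < x := by linarith
  have hx0' : 0 < x' := by linarith
  have hds := abs_nonneg (s - s')
  have hdx := abs_nonneg (x - x')
  have hlog := log_perturb_le hlo hx hx' hu
  have hquad := mul_inv_lipschitz (q := q) (r := r) (s := s) hlo hS (by linarith : lo ≤ x + u)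
    (by linarith : lo ≤ x' + u) hs'
  rw [add_sub_add_right_eq_sub] at hquad
  have hlin := sq_mul_inv_mul_inv_lipschitz (r := r) hlo hS hx hx' hs hs' hu
  have e : (gaussLoss s x q u - gaussLoss s' x' q u) - (gaussLoss s x r 0 - gaussLoss s' x' r 0) =
      ((Real.log (x + u) - Real.log (x' + u)) - (Real.log x - Real.log x')) +
      ((q - r) * ((q + r - 2 * s) * (x + u)⁻¹ - (q + r - 2 * s') * (x' + u)⁻¹) +
       (-u) * ((r - s) ^ 2 * (x⁻¹ * (x + u)⁻¹) - (r - s') ^ 2 * (x'⁻¹ * (x' + u)⁻¹))) := by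
    have hne : x + u ≠ 0 := by positivity
    have hne' : x' + u ≠ 0 := by positivity
    have e1 : (x + u)⁻¹ - x⁻¹ = (-u) * (x⁻¹ * (x + u)⁻¹) := by field_simp; ring
    have e2 : (x' + u)⁻¹ - x'⁻¹ = (-u) * (x'⁻¹ * (x' + u)⁻¹) := by field_simp; ring
    simp only [gaussLoss, add_zero, div_eq_mul_inv]
    linear_combination (r - s) ^ 2 * e1 - (r - s') ^ 2 * e2
  rw [e]
  refine (abs_add_le _ _).trans ((add_le_add hlog (abs_add_le _ _)).trans ?_)
  rw [abs_mul, abs_mul, abs_neg, abs_of_nonneg hu]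
  have h1 : u / lo ^ 2 * |x - x'| ≤ 1 / lo ^ 2 * (u * (1 + r ^ 2)) * (|s - s'| + |x - x'|) := by
    have : u ≤ u * (1 + r ^ 2) := le_mul_of_one_le_right hu (by nlinarith [sq_nonneg r])
    calc _ = 1 / lo ^ 2 * u * |x - x'| := by ring
      _ ≤ _ := by gcongr; linarith
  have h2 := mul_le_mul_of_nonneg_left hquad (abs_nonneg (q - r))
  have h3 := mul_le_mul_of_nonneg_left hlin hu
  generalize 2 / lo + (1 + 2 * S) / lo ^ 2 = A at *
  generalize 2 * (1 + S) / lo ^ 2 + 4 * (1 + S) ^ 2 / lo ^ 3 = B at *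
  generalize 1 / lo ^ 2 = E at *
  have hD : 0 ≤ |s - s'| + |x - x'| := by positivity
  generalize |s - s'| + |x - x'| = D at *
  have hG : 0 ≤ |q - r| * (|q| + |r| + 1) := by positivity
  have hH : 0 ≤ u * (1 + r ^ 2) := by positivity
  have h4 : 0 ≤ (A * (u * (1 + r ^ 2)) + (B + E) * (|q - r| * (|q| + |r| + 1))) * D := by
    positivity
  linarith

/-! ### Pathwise localization of the maximizer -/

/-- Applying `log t ≤ t - 1` to `v / x` gives only nonnegativity. Applied to `√v / √x` and doubled,
it leaves the square `((√v - √x) / √x)²`, which yields the quadratic separation. -/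
lemma log_add_div_sub_ge {x v hi : ℝ} (hx : 0 < x) (hv : 0 < v) (hxh : x ≤ hi) (hvh : v ≤ hi) :
    (x - v) ^ 2 / (4 * hi ^ 2) ≤ Real.log x + v / x - Real.log v - 1 := by
  have hsx := Real.sqrt_pos.2 hx
  have hsv := Real.sqrt_pos.2 hv
  have ex := Real.sq_sqrt hx.le
  have ev := Real.sq_sqrt hv.le
  set p := √x
  set q := √v
  have h1 : Real.log v - Real.log x ≤ 2 * ((q - p) / p) := by
    have := log_sub_log_le hsv hsx
    rw [← ex, ← ev, Real.log_pow, Real.log_pow]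
    push_cast
    linarith
  have h2 : (q - p) ^ 2 / p ^ 2 = v / x - 1 - 2 * ((q - p) / p) := by
    rw [← ex, ← ev]; field_simp; ring
  have h3 : (x - v) ^ 2 / (4 * hi ^ 2) ≤ (q - p) ^ 2 / p ^ 2 := by
    have e : (x - v) ^ 2 = (q - p) ^ 2 * (q + p) ^ 2 := by rw [← ex, ← ev]; ring
    have hhi : 0 < hi := by linarith
    have h4 : (q + p) ^ 2 ≤ 4 * hi := by nlinarith [sq_nonneg (q - p)]
    rw [e, div_le_div_iff₀ (by positivity) (by positivity)]
    calc (q - p) ^ 2 * (q + p) ^ 2 * p ^ 2 ≤ (q - p) ^ 2 * (4 * hi) * hi := by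
          rw [ex]; gcongr
      _ = _ := by ring
  linarith

/-- If the summands of the quasi-likelihood differ from those of an i.i.d. Gaussian likelihood by
terms with small Lipschitz constants, then a maximizer is close to the empirical mean and
variance. -/
lemma isQMLE_close {X r κ : ℕ → ℝ} {n : ℕ} {y sLo sHi xLo xHi m w K : ℝ}
    {z : EuclideanSpace ℝ (Fin 2)} (hn : 0 < n) (hlo : 0 < xLo) (hK0 : 0 ≤ K)
    (hκ : ∀ k, ∀ s s' x x' : ℝ, (sLo ≤ s ∧ s ≤ sHi) → (sLo ≤ s' ∧ s' ≤ sHi) →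
      (xLo ≤ x ∧ x ≤ xHi) → (xLo ≤ x' ∧ x' ≤ xHi) →
      |((Real.log (x * X k ^ 2 + y) + (X (k + 1) - s * X k) ^ 2 / (x * X k ^ 2 + y)) -
        (Real.log (x' * X k ^ 2 + y) + (X (k + 1) - s' * X k) ^ 2 / (x' * X k ^ 2 + y))) -
        (gaussLoss s x (r k) 0 - gaussLoss s' x' (r k) 0)| ≤ κ k * (|s - s'| + |x - x'|))
    (hK : ∑ k ∈ Finset.range n, κ k ≤ K)
    (hm : (n : ℝ) * m = ∑ k ∈ Finset.range n, r k)
    (hw : (n : ℝ) * (w + m ^ 2) = ∑ k ∈ Finset.range n, r k ^ 2)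
    (hms : sLo ≤ m ∧ m ≤ sHi) (hwx : xLo ≤ w ∧ w ≤ xHi)
    (hz : IsQMLE X n y (paramRect sLo sHi xLo xHi) z) :
    |z 0 - m| + |z 1 - w| ≤ (2 * (4 * xHi ^ 2 + xHi) * K) / n := by
  obtain ⟨⟨hz0, hz1⟩, hmax⟩ := hz
  have hhi : 0 < xHi := by linarith [hwx.1, hwx.2]
  have hw0 : 0 < w := by linarith [hwx.1]
  have hz10 : 0 < z 1 := by linarith [hz1.1]
  have hn' : (0 : ℝ) < n := by exact_mod_cast hn
  -- The competitor is the exact Gaussian maximizer `(m, w)`, the empirical mean and variance.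
  have hq := hmax (show (!₂[m, w] : EuclideanSpace ℝ (Fin 2)) ∈ paramRect sLo sHi xLo xHi from
    ⟨by simpa using hms, by simpa using hwx⟩)
  simp only [Set.mem_ofPred_eq, quasiLogLik] at hq
  rw [← Finset.mul_sum, ← Finset.mul_sum] at hq
  set D := |z 0 - m| + |z 1 - w| with hD
  have hsum : ∀ s x : ℝ, 0 < x → ∑ k ∈ Finset.range n, gaussLoss s x (r k) 0 =
      n * (Real.log x + w / x + (m - s) ^ 2 / x) := by
    intro s x hx
    have e : ∀ k, gaussLoss s x (r k) 0 =
        (Real.log x + s ^ 2 / x) + (r k ^ 2 * (1 / x) + r k * (-2 * s / x)) := by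
      intro k
      simp only [gaussLoss, add_zero]
      ring
    simp_rw [e]
    rw [Finset.sum_add_distrib, Finset.sum_add_distrib (f := fun k => r k ^ 2 * (1 / x)),
      ← Finset.sum_mul, ← Finset.sum_mul, ← hm,
      ← hw, Finset.sum_const, Finset.card_range, nsmul_eq_mul]
    field_simp
    ring
  have h1 : ∑ k ∈ Finset.range n, (gaussLoss (z 0) (z 1) (r k) 0 - gaussLoss m w (r k) 0) ≤
      K * D := by
    have h2 : ∀ k ∈ Finset.range n,
        (gaussLoss (z 0) (z 1) (r k) 0 - gaussLoss m w (r k) 0) ≤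
        ((Real.log (z 1 * X k ^ 2 + y) + (X (k + 1) - z 0 * X k) ^ 2 / (z 1 * X k ^ 2 + y)) -
        (Real.log (w * X k ^ 2 + y) + (X (k + 1) - m * X k) ^ 2 / (w * X k ^ 2 + y))) +
          κ k * D := by
      intro k _
      have := (abs_le.1 (hκ k (z 0) m (z 1) w hz0 hms hz1 hwx)).1
      linarith
    refine (Finset.sum_le_sum h2).trans ?_
    rw [Finset.sum_add_distrib, Finset.sum_sub_distrib, ← Finset.sum_mul]
    have h3 : (∑ k ∈ Finset.range n, κ k) * D ≤ K * D := by gcongr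
    simp only [Matrix.cons_val_zero, Matrix.cons_val_one] at hq
    linarith
  rw [Finset.sum_sub_distrib, hsum _ _ hz10, hsum _ _ hw0] at h1
  have h4 := log_add_div_sub_ge hz10 hw0 hz1.2 hwx.2
  have h5 : (z 0 - m) ^ 2 / xHi ≤ (m - z 0) ^ 2 / z 1 := by
    rw [show (m - z 0) ^ 2 = (z 0 - m) ^ 2 by ring]
    gcongr
    exact hz1.2
  have h6 : (n : ℝ) * ((z 1 - w) ^ 2 / (4 * xHi ^ 2) + (z 0 - m) ^ 2 / xHi) ≤ K * D := by
    refine le_trans ?_ h1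
    rw [← mul_sub]
    gcongr
    have : w / w = 1 := div_self hw0.ne'
    simp only [sub_self, this]
    norm_num
    linarith
  -- The denominator `4 xHi² + xHi` dominates both curvature denominators; the factor 2 comes from
  -- `(a + b)² ≤ 2 (a² + b²)`.
  have h7 : D ^ 2 / (2 * (4 * xHi ^ 2 + xHi)) ≤
      (z 1 - w) ^ 2 / (4 * xHi ^ 2) + (z 0 - m) ^ 2 / xHi := by
    have h8 : D ^ 2 ≤ 2 * ((z 1 - w) ^ 2 + (z 0 - m) ^ 2) := by
      rw [hD]
      nlinarith [sq_abs (z 0 - m), sq_abs (z 1 - w), sq_nonneg (|z 0 - m| - |z 1 - w|)]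
    calc D ^ 2 / (2 * (4 * xHi ^ 2 + xHi)) ≤
          2 * ((z 1 - w) ^ 2 + (z 0 - m) ^ 2) / (2 * (4 * xHi ^ 2 + xHi)) := by gcongr
      _ = (z 1 - w) ^ 2 / (4 * xHi ^ 2 + xHi) + (z 0 - m) ^ 2 / (4 * xHi ^ 2 + xHi) := by
        field_simp
      _ ≤ _ := by
        gcongr
        · linarith
        · nlinarith
  have hD0 : 0 ≤ D := by positivity
  rcases hD0.eq_or_lt with h0 | hpos
  · rw [← h0]
    positivity
  · have h9 : (n : ℝ) * (D ^ 2 / (2 * (4 * xHi ^ 2 + xHi))) ≤ K * D :=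
      le_trans (by gcongr) h6
    rw [le_div_iff₀ hn']
    have hc : 0 < 2 * (4 * xHi ^ 2 + xHi) := by positivity
    rw [← mul_div_assoc, div_le_iff₀ hc] at h9
    have : D * (D * n) ≤ D * (2 * (4 * xHi ^ 2 + xHi) * K) := by nlinarith
    exact le_of_mul_le_mul_left this hpos

/-- Where `|X k|⁻¹ ≤ 1`, the perturbations `ε k / X k` and `y / X k²` are at most `|X k|⁻¹` times
`|ε k|` and `y`, and the quadratic factors are absorbed by the weight `1 + β k² + ε k²`. The
remaining indices are finitely many and need only some constant. -/
lemma exists_summable_lipschitz {X β ε : ℕ → ℝ} {φ y sLo sHi xLo xHi : ℝ} (hlo : 0 < xLo)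
    (hy : 0 < y) (hrec : ∀ k, X (k + 1) = (φ + β k) * X k + ε k)
    (hX : ∀ᶠ k in atTop, X k ≠ 0)
    (hsum : Summable fun k => |X k|⁻¹ * (1 + β k ^ 2 + ε k ^ 2)) :
    ∃ κ : ℕ → ℝ, (∀ k, 0 ≤ κ k) ∧ Summable κ ∧
      ∀ k, ∀ s s' x x' : ℝ, (sLo ≤ s ∧ s ≤ sHi) → (sLo ≤ s' ∧ s' ≤ sHi) →
      (xLo ≤ x ∧ x ≤ xHi) → (xLo ≤ x' ∧ x' ≤ xHi) →
      |((Real.log (x * X k ^ 2 + y) + (X (k + 1) - s * X k) ^ 2 / (x * X k ^ 2 + y)) -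
        (Real.log (x' * X k ^ 2 + y) + (X (k + 1) - s' * X k) ^ 2 / (x' * X k ^ 2 + y))) -
        (gaussLoss s x (φ + β k) 0 - gaussLoss s' x' (φ + β k) 0)| ≤
          κ k * (|s - s'| + |x - x'|) := by
  set S := max |sLo| |sHi|
  have hS0 : 0 ≤ S := le_max_of_le_left (abs_nonneg _)
  have hS : ∀ s, (sLo ≤ s ∧ s ≤ sHi) → |s| ≤ S := fun s hs => by
    rw [abs_le]
    exact ⟨by linarith [neg_abs_le sLo, le_max_left |sLo| |sHi|],
      by linarith [le_abs_self sHi, le_max_right |sLo| |sHi|]⟩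
  obtain ⟨C, hC, hpert⟩ := gaussLoss_perturb (S := S) hlo
  have hex : ∀ k, ∃ c : ℝ, 0 ≤ c ∧ (X k ≠ 0 → |X k|⁻¹ ≤ 1 →
        c ≤ C * ((3 + y) * (2 + 2 * φ ^ 2)) * (|X k|⁻¹ * (1 + β k ^ 2 + ε k ^ 2))) ∧
      ∀ s s' x x' : ℝ, (sLo ≤ s ∧ s ≤ sHi) → (sLo ≤ s' ∧ s' ≤ sHi) →
      (xLo ≤ x ∧ x ≤ xHi) → (xLo ≤ x' ∧ x' ≤ xHi) →
      |((Real.log (x * X k ^ 2 + y) + (X (k + 1) - s * X k) ^ 2 / (x * X k ^ 2 + y)) -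
        (Real.log (x' * X k ^ 2 + y) + (X (k + 1) - s' * X k) ^ 2 / (x' * X k ^ 2 + y))) -
        (gaussLoss s x (φ + β k) 0 - gaussLoss s' x' (φ + β k) 0)| ≤
          c * (|s - s'| + |x - x'|) := by
    intro k
    rcases eq_or_ne (X k) 0 with h0 | h0
    -- At `X k = 0` the likelihood summand does not depend on the parameters, so only the
    -- unperturbed criterion has to be bounded.
    · refine ⟨1 / xLo + 2 * (|φ + β k| + S) / xLo + (|φ + β k| + S) ^ 2 / xLo ^ 2,
        by positivity, fun h => absurd h0 h, ?_⟩
      intro s s' x x' hs hs' hx hx'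
      rw [h0]
      simp only [ne_eq, OfNat.ofNat_ne_zero, not_false_eq_true, zero_pow, mul_zero, zero_add,
        sub_zero, sub_self, zero_sub, abs_neg]
      exact gaussLoss_lipschitz hlo hx.1 hx'.1 (hS s hs) (hS s' hs')
    · have hu : 0 ≤ y / X k ^ 2 := by positivity
      refine ⟨C * (|X (k + 1) / X k - (φ + β k)| * (|X (k + 1) / X k| + |φ + β k| + 1) +
        y / X k ^ 2 * (1 + (φ + β k) ^ 2)), by positivity, fun _ h1 => ?_, ?_⟩
      · have e1 : X (k + 1) / X k = (φ + β k) + ε k * (X k)⁻¹ := by rw [hrec]; field_simp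
        have e2 : y / X k ^ 2 = y * |X k|⁻¹ ^ 2 := by
          rw [inv_pow, sq_abs]; rfl
        rw [e1, e2, add_sub_cancel_left, mul_assoc C]
        gcongr C * ?_
        have h2 : |φ + β k + ε k * (X k)⁻¹| ≤ |φ + β k| + |ε k| := by
          refine (abs_add_le _ _).trans ?_
          rw [abs_mul, abs_inv]
          gcongr
          exact mul_le_of_le_one_right (abs_nonneg _) h1
        have hh : 0 ≤ |X k|⁻¹ := by positivity
        rw [abs_mul, abs_inv]
        set h := |X k|⁻¹
        have h3 : (φ + β k) ^ 2 ≤ 2 * φ ^ 2 + 2 * β k ^ 2 := by nlinarith [sq_nonneg (φ - β k)]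
        have h4 : |ε k| * (2 * |φ + β k| + |ε k| + 1) ≤ 3 * ε k ^ 2 + (φ + β k) ^ 2 + 1 := by
          nlinarith [sq_abs (ε k), sq_abs (φ + β k), sq_nonneg (|ε k| - |φ + β k|),
            sq_nonneg (|ε k| - 1)]
        calc |ε k| * h * (|φ + β k + ε k * (X k)⁻¹| + |φ + β k| + 1) +
              y * h ^ 2 * (1 + (φ + β k) ^ 2)
            ≤ |ε k| * h * ((|φ + β k| + |ε k|) + |φ + β k| + 1) +
              y * (h * 1) * (1 + (φ + β k) ^ 2) := by
              rw [sq]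
              gcongr
          _ = h * (|ε k| * (2 * |φ + β k| + |ε k| + 1) + y * (1 + (φ + β k) ^ 2)) := by ring
          _ ≤ h * ((3 * ε k ^ 2 + (2 * φ ^ 2 + 2 * β k ^ 2) + 1) +
                y * (1 + (2 * φ ^ 2 + 2 * β k ^ 2))) := by
              gcongr
              linarith
          _ ≤ h * (((3 + y) * (2 + 2 * φ ^ 2)) * (1 + β k ^ 2 + ε k ^ 2)) := by
              gcongr
              have a1 := sq_nonneg (ε k)
              have a2 := sq_nonneg (β k)
              have a3 := sq_nonneg φ
              have a4 := mul_nonneg hy.le a1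
              have a5 := mul_nonneg hy.le a2
              have a6 := mul_nonneg hy.le a3
              have a7 := mul_nonneg a3 a1
              have a8 := mul_nonneg a3 a2
              have a9 := mul_nonneg hy.le a7
              have a10 := mul_nonneg hy.le a8
              nlinarith
          _ = _ := by ring
      · intro s s' x x' hs hs' hx hx'
        rw [quasiLogLik_term h0 (hlo.trans_le hx.1) hy, quasiLogLik_term h0 (hlo.trans_le hx'.1) hy,
          add_sub_add_left_eq_sub]
        exact hpert hx.1 hx'.1 (hS s hs) (hS s' hs') hu
  choose κ hκ0 hκ1 hκ2 using hex
  refine ⟨κ, hκ0, ?_, hκ2⟩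
  -- The weight is at least 1, so summability itself forces `|X k|⁻¹ → 0`.
  have hsmall : ∀ᶠ k in atTop, |X k|⁻¹ ≤ 1 := by
    have := hsum.tendsto_atTop_zero.eventually (gt_mem_nhds zero_lt_one)
    filter_upwards [this] with k hk
    refine le_trans ?_ hk.le
    exact le_mul_of_one_le_right (by positivity) (by nlinarith [sq_nonneg (β k), sq_nonneg (ε k)])
  refine Summable.of_norm_bounded_eventually_nat
    (hsum.mul_left (C * ((3 + y) * (2 + 2 * φ ^ 2)))) ?_
  filter_upwards [hX, hsmall] with k h1 h2
  rw [Real.norm_of_nonneg (hκ0 k)]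
  exact hκ1 k h1 h2

/-- Along an explosive path, the quasi-maximum likelihood estimator is within `O(1 / n)` of the
empirical mean and variance of the random coefficients. -/
lemma exists_isQMLE_close {X β ε : ℕ → ℝ} {φ y sLo sHi xLo xHi : ℝ} (hlo : 0 < xLo)
    (hy : 0 < y) (hrec : ∀ k, X (k + 1) = (φ + β k) * X k + ε k)
    (hX : ∀ᶠ k in atTop, X k ≠ 0)
    (hsum : Summable fun k => |X k|⁻¹ * (1 + β k ^ 2 + ε k ^ 2)) :
    ∃ C : ℝ, ∀ (n : ℕ) (z : EuclideanSpace ℝ (Fin 2)) (m w : ℝ), 0 < n →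
      (n : ℝ) * m = ∑ k ∈ Finset.range n, (φ + β k) →
      (n : ℝ) * (w + m ^ 2) = ∑ k ∈ Finset.range n, (φ + β k) ^ 2 →
      (sLo ≤ m ∧ m ≤ sHi) → (xLo ≤ w ∧ w ≤ xHi) →
      IsQMLE X n y (paramRect sLo sHi xLo xHi) z → |z 0 - m| + |z 1 - w| ≤ C / n := by
  obtain ⟨κ, hκ0, hκs, hκ⟩ := exists_summable_lipschitz (sLo := sLo) (sHi := sHi) (xHi := xHi)
    hlo hy hrec hX hsum
  refine ⟨2 * (4 * xHi ^ 2 + xHi) * ∑' k, κ k, fun n z m w hn hm hw hms hwx hz => ?_⟩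
  exact isQMLE_close hn hlo (tsum_nonneg hκ0) hκ (hκs.sum_le_tsum _ fun k _ => hκ0 k) hm hw hms
    hwx hz

/-! ### Non-negligibility of orbits of random affine maps -/

/-- The orbit of `c` under the random affine maps `x ↦ A x + B`, `(A, B) = p k`. -/
def affinePath (p : ℕ → ℝ × ℝ) (c : ℝ) : ℕ → ℝ
  | 0 => c
  | k + 1 => (p k).1 * affinePath p c k + (p k).2

/-- The set of sequences of affine maps along which the orbit of `c` is negligible with respect to
the product of the linear parts. -/
def negligibleOrbit (c : ℝ) : Set (ℕ → ℝ × ℝ) :=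
  {p | Tendsto (fun n => affinePath p c n / ∏ k ∈ Finset.range n, (p k).1) atTop (𝓝 0)}

/-- Peels off the first map instead of the last, as conditioning on the first step requires. -/
lemma affinePath_succ' (p : ℕ → ℝ × ℝ) (c : ℝ) (n : ℕ) :
    affinePath p c (n + 1) = affinePath (fun k => p (k + 1)) ((p 0).1 * c + (p 0).2) n := by
  induction n with
  | zero => rfl
  | succ n ih => rw [affinePath, ih]; rfl

lemma affinePath_sub (p : ℕ → ℝ × ℝ) (c d : ℝ) (n : ℕ) :
    affinePath p c n - affinePath p d n = (∏ k ∈ Finset.range n, (p k).1) * (c - d) := by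
  induction n with
  | zero => simp [affinePath]
  | succ n ih =>
    rw [affinePath, affinePath, Finset.prod_range_succ]
    linear_combination (p n).1 * ih

lemma measurable_affinePath (n : ℕ) :
    Measurable fun x : ℝ × (ℕ → ℝ × ℝ) => affinePath x.2 x.1 n := by
  induction n with
  | zero => exact measurable_fst
  | succ n ih =>
    simp only [affinePath]
    fun_prop

/-- Joint measurability in starting point and sequence makes the probability of negligibility a
measurable function of the starting point. -/
lemma measurableSet_negligibleOrbit :
    MeasurableSet {x : ℝ × (ℕ → ℝ × ℝ) | x.2 ∈ negligibleOrbit x.1} := by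
  have : ∀ n, Measurable fun x : ℝ × (ℕ → ℝ × ℝ) =>
      affinePath x.2 x.1 n / ∏ k ∈ Finset.range n, (x.2 k).1 := fun n =>
    (measurable_affinePath n).div (Finset.measurable_prod _ fun k _ => by fun_prop)
  exact measurableSet_tendsto _ this

lemma measurableSet_negligibleOrbit_right (c : ℝ) : MeasurableSet (negligibleOrbit c) :=
  measurableSet_negligibleOrbit.preimage (measurable_const.prodMk measurable_id)

lemma mem_negligibleOrbit_iff_shift {p : ℕ → ℝ × ℝ} {c : ℝ} (h : (p 0).1 ≠ 0) :
    p ∈ negligibleOrbit c ↔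
      (fun k => p (k + 1)) ∈ negligibleOrbit ((p 0).1 * c + (p 0).2) := by
  simp only [negligibleOrbit, Set.mem_ofPred_eq]
  rw [← tendsto_add_atTop_iff_nat 1]
  simp_rw [affinePath_succ', Finset.prod_range_succ', ← div_div]
  constructor
  · intro H
    have := H.mul_const (p 0).1
    simpa [div_mul_cancel₀ _ h] using this
  · intro H
    simpa using H.div_const (p 0).1

/-- After normalization, two orbits of the same sequence differ by the constant `c - d`. -/
lemma negligibleOrbit_inj {p : ℕ → ℝ × ℝ} {c d : ℝ} (h : ∀ k, (p k).1 ≠ 0)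
    (hc : p ∈ negligibleOrbit c) (hd : p ∈ negligibleOrbit d) : c = d := by
  have := Tendsto.sub hc hd
  simp_rw [← sub_div, affinePath_sub] at this
  have e : ∀ n, (∏ k ∈ Finset.range n, (p k).1) * (c - d) / ∏ k ∈ Finset.range n, (p k).1 =
      c - d := fun n => mul_div_cancel_left₀ _ (Finset.prod_ne_zero_iff.2 fun k _ => h k)
  simp_rw [e] at this
  have := tendsto_nhds_unique this tendsto_const_nhds
  linarith

/-- The first coordinate and the shifted sequence of an i.i.d. sequence are independent, and the
shifted sequence has the same law. -/
lemma infinitePi_map_head_tail {α : Type*} [MeasurableSpace α] (ν : Measure α)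
    [IsProbabilityMeasure ν] :
    (Measure.infinitePi fun _ : ℕ => ν).map (fun p => (p 0, fun k => p (k + 1))) =
      ν.prod (Measure.infinitePi fun _ : ℕ => ν) := by
  set μ := Measure.infinitePi fun _ : ℕ => ν with hμ
  have hind : iIndepFun (fun (i : ℕ) (p : ℕ → α) => p i) μ :=
    iIndepFun_infinitePi (P := fun _ : ℕ => ν) (X := fun _ x => x) (fun _ => measurable_id)
  have hev : ∀ k, μ.map (fun p : ℕ → α => p k) = ν := fun k =>
    (measurePreserving_eval_infinitePi (fun _ : ℕ => ν) k).map_eq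
  have htail : μ.map (fun (p : ℕ → α) (k : ℕ) => p (k + 1)) = μ := by
    have h1 : iIndepFun (fun (i : ℕ) (p : ℕ → α) => p (i + 1)) μ :=
      hind.precomp (g := fun i : ℕ => i + 1) (add_left_injective 1)
    rw [h1.map_fun_eq_infinitePi_map (fun k => measurable_pi_apply (k + 1))]
    simp_rw [hev]
    rfl
  have hindep : IndepFun (fun p : ℕ → α => p 0) (fun (p : ℕ → α) (k : ℕ) => p (k + 1)) μ := by
    have h2 := indep_iSup_of_disjoint (μ := μ)
      (m := fun k : ℕ => MeasurableSpace.comap (fun p : ℕ → α => p k) inferInstance)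
      (fun k => (measurable_pi_apply k).comap_le) hind
      (S := {0}) (T := {k | 1 ≤ k}) (by simp)
    rw [IndepFun_iff_Indep]
    refine indep_of_indep_of_le_right (indep_of_indep_of_le_left h2 ?_) ?_
    · exact le_iSup₂_of_le 0 rfl le_rfl
    · rw [MeasurableSpace.pi, MeasurableSpace.comap_iSup]
      refine iSup_le fun k => ?_
      rw [MeasurableSpace.comap_comp]
      exact le_iSup₂_of_le (k + 1) (show 1 ≤ k + 1 by lia) le_rfl
  rw [(indepFun_iff_map_prod_eq_prod_map_map
    (Measurable.aemeasurable (by fun_prop)) (Measurable.aemeasurable (by fun_prop))).1 hindep, hev, htail]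

/-- A random affine recursion with no common fixed point, which is not almost surely
non-expansive, has almost surely no negligible orbit of a given starting point. -/
theorem infinitePi_negligibleOrbit (ν : Measure (ℝ × ℝ)) [IsProbabilityMeasure ν]
    (h0 : ∀ᵐ p ∂ν, p.1 ≠ 0) (h1 : ¬ ∀ᵐ p ∂ν, |p.1| ≤ 1)
    (hfix : ∀ z : ℝ, ¬ ∀ᵐ p ∂ν, p.1 * z + p.2 = z) (c : ℝ) :
    (Measure.infinitePi fun _ : ℕ => ν) (negligibleOrbit c) = 0 := by
  set μ := Measure.infinitePi fun _ : ℕ => ν with hμ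
  have hev : ∀ k, MeasurePreserving (fun p : ℕ → ℝ × ℝ => p k) μ ν := fun k =>
    measurePreserving_eval_infinitePi (fun _ : ℕ => ν) k
  have hall : ∀ᵐ p ∂μ, ∀ k, (p k).1 ≠ 0 :=
    ae_all_iff.2 fun k => (hev k).quasiMeasurePreserving.ae h0
  set q : ℝ → ENNReal := fun c => μ (negligibleOrbit c) with hq
  have hqm : Measurable q := measurable_measure_prodMk_left measurableSet_negligibleOrbit
  -- Harmonicity: condition on the first affine map.
  have hint : ∀ c, q c = ∫⁻ p, q (p.1 * c + p.2) ∂ν := by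
    intro c
    set E : Set ((ℝ × ℝ) × (ℕ → ℝ × ℝ)) := {x | x.2 ∈ negligibleOrbit (x.1.1 * c + x.1.2)}
    have hE : MeasurableSet E := measurableSet_negligibleOrbit.preimage
      (f := fun x : (ℝ × ℝ) × (ℕ → ℝ × ℝ) => (x.1.1 * c + x.1.2, x.2)) (by fun_prop)
    have e1 : q c = μ ((fun p => (p 0, fun k => p (k + 1))) ⁻¹' E) := by
      refine measure_congr ?_
      filter_upwards [hall] with p hp
      exact propext (mem_negligibleOrbit_iff_shift (hp 0))
    rw [e1, ← Measure.map_apply (by fun_prop) hE, infinitePi_map_head_tail, Measure.prod_apply hE]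
    rfl
  -- The events for distinct starting points are almost surely disjoint. Hence the superlevel sets
  -- of `q` at positive levels are finite, and `q` attains its maximum if it is not identically
  -- zero.
  have hsum : ∀ F : Finset ℝ, ∑ c ∈ F, q c ≤ 1 := by
    intro F
    have hd : Set.Pairwise (↑F) (Function.onFun (AEDisjoint μ) negligibleOrbit) := by
      intro c _ d _ hcd
      have : ∀ᵐ p ∂μ, p ∉ negligibleOrbit c ∩ negligibleOrbit d := by
        filter_upwards [hall] with p hp h
        exact hcd (negligibleOrbit_inj hp h.1 h.2)
      exact measure_eq_zero_iff_ae_notMem.2 this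
    rw [← measure_biUnion_finset₀ hd
      fun c _ => (measurableSet_negligibleOrbit_right c).nullMeasurableSet]
    exact prob_le_one
  have hfin : ∀ ε : ENNReal, ε ≠ 0 → {c | ε ≤ q c}.Finite := by
    intro ε hε
    by_contra hinf
    obtain ⟨N, hN⟩ := ENNReal.exists_nat_mul_gt hε ENNReal.one_ne_top
    obtain ⟨F, hF, hcard⟩ := Set.Infinite.exists_subset_card_eq hinf N
    have := hsum F
    have h2 : F.card • ε ≤ ∑ c ∈ F, q c := Finset.card_nsmul_le_sum _ _ _ fun c hc => hF hc
    rw [hcard, nsmul_eq_mul] at h2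
    exact absurd (h2.trans this) (not_le.2 hN)
  by_contra hc
  change q c ≠ 0 at hc
  obtain ⟨c₀, hc₀, hmax⟩ := (hfin _ hc).exists_maximalFor q _ ⟨c, show q c ≤ q c from le_rfl⟩
  have hm0 : q c₀ ≠ 0 := fun h => hc (le_antisymm (h ▸ hc₀) bot_le)
  have hle : ∀ d, q d ≤ q c₀ := by
    intro d
    rcases le_total (q d) (q c₀) with h | h
    · exact h
    · exact hmax (le_trans hc₀ h) h
  set M := {d | q c₀ ≤ q d} with hM
  have hMfin : M.Finite := hfin _ hm0
  have hMne : M.Nonempty := ⟨c₀, show q c₀ ≤ q c₀ from le_rfl⟩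
  -- Maximum principle: an average of values at most `q c₀` that equals `q c₀` forces equality
  -- almost everywhere.
  have hinv : ∀ d ∈ M, ∀ᵐ p ∂ν, p.1 * d + p.2 ∈ M := by
    intro d hd
    have e : q d = q c₀ := le_antisymm (hle d) hd
    have hlt : q c₀ ≠ ⊤ := measure_ne_top _ _
    have hmeas : Measurable fun p : ℝ × ℝ => q (p.1 * d + p.2) := hqm.comp (by fun_prop)
    have h2 : ∫⁻ p, q (p.1 * d + p.2) ∂ν ≠ ⊤ := by rw [← hint, e]; exact hlt
    have h3 := ae_eq_of_ae_le_of_lintegral_le (μ := ν) (f := fun p => q (p.1 * d + p.2))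
      (g := fun _ => q c₀) (ae_of_all _ fun p => hle _) h2 measurable_const.aemeasurable
      (by rw [← hint, e]; simp)
    filter_upwards [h3] with p hp
    exact hp.ge
  obtain ⟨a, ha, hamax⟩ := hMfin.exists_maximalFor id _ hMne
  obtain ⟨i, hi, himin⟩ := hMfin.exists_minimalFor id _ hMne
  have hamax' : ∀ d ∈ M, d ≤ a := fun d hd => (le_total d a).elim id fun h => hamax hd h
  have himin' : ∀ d ∈ M, i ≤ d := fun d hd => (le_total i d).elim id fun h => himin hd h
  -- A finite invariant set is either a single point, hence a common fixed point, or has positive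
  -- diameter `a - i`. In the latter case the images of its extremes stay within that diameter, so
  -- the slope is at most 1 in absolute value.
  rcases (hamax' i hi).eq_or_lt with h | h
  · refine hfix i ?_
    filter_upwards [hinv i hi] with p hp
    exact le_antisymm ((hamax' _ hp).trans h.ge) (himin' _ hp)
  · refine h1 ?_
    filter_upwards [hinv i hi, hinv a ha] with p hpi hpa
    have h2 : |p.1| * (a - i) ≤ 1 * (a - i) := by
      rw [← abs_of_pos (sub_pos.2 h), ← abs_mul, abs_of_pos (sub_pos.2 h), abs_le]
      have := hamax' _ hpi
      have := hamax' _ hpa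
      have := himin' _ hpi
      have := himin' _ hpa
      constructor <;> linarith
    exact le_of_mul_le_mul_right h2 (sub_pos.2 h)

/-! ### Exponential growth of the path -/

lemma rcaPath_eq_affinePath (φ x₀ : ℝ) (b e : ℕ → ℝ) (n : ℕ) :
    rcaPath φ x₀ b e n = affinePath (fun k => (φ + b (k + 1), e (k + 1))) x₀ n := by
  induction n with
  | zero => rfl
  | succ n ih => rw [rcaPath, affinePath, ih]

/-- The normalized orbit has increments `(p n).2 / Q (n + 1)`, which are absolutely summable, so it
converges. Non-negligibility makes the limit `W` nonzero, and the orbit eventually exceeds `|W| / 2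
* exp (g k)` in absolute value. -/
lemma summable_inv_abs_affinePath {p : ℕ → ℝ × ℝ} {c g : ℝ} {Y : ℕ → ℝ}
    (hA : ∀ k, (p k).1 ≠ 0) (hg : 0 ≤ g)
    (hprod : ∀ᶠ n : ℕ in atTop, Real.exp (g * n) ≤ |∏ k ∈ Finset.range n, (p k).1|)
    (hBY : ∀ k, |(p k).2| ≤ Y k) (hY : Summable fun k : ℕ => Real.exp (-(g * k)) * Y k)
    (hc : p ∉ negligibleOrbit c) :
    (∀ᶠ k in atTop, affinePath p c k ≠ 0) ∧ Summable fun k => |affinePath p c k|⁻¹ * Y k := by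
  set Q : ℕ → ℝ := fun n => ∏ k ∈ Finset.range n, (p k).1 with hQ
  have hQ0 : ∀ n, Q n ≠ 0 := fun n => Finset.prod_ne_zero_iff.2 fun k _ => hA k
  set R : ℕ → ℝ := fun n => affinePath p c n / Q n with hR
  have hY0 : ∀ k, 0 ≤ Y k := fun k => (abs_nonneg _).trans (hBY k)
  have hdiff : ∀ n, dist (R n) (R (n + 1)) = |(p n).2| * |Q (n + 1)|⁻¹ := by
    intro n
    rw [dist_comm, Real.dist_eq, ← abs_inv, ← abs_mul]
    congr 1
    have hs : Q (n + 1) = Q n * (p n).1 := Finset.prod_range_succ _ _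
    simp only [hR, affinePath, hs]
    have := hQ0 n
    have := hA n
    field_simp
    ring
  have hsum : Summable fun n => dist (R n) (R (n + 1)) := by
    refine Summable.of_norm_bounded_eventually_nat hY ?_
    filter_upwards [(tendsto_add_atTop_nat 1).eventually hprod] with n hn
    rw [Real.norm_of_nonneg dist_nonneg, hdiff, mul_comm]
    gcongr ?_ * ?_
    · rw [Real.exp_neg]
      refine inv_anti₀ (Real.exp_pos _) (le_trans (Real.exp_le_exp.2 ?_) hn)
      push_cast
      nlinarith
    · exact hBY n
  obtain ⟨W, hW⟩ := cauchySeq_tendsto_of_complete (cauchySeq_of_summable_dist hsum)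
  have hW0 : W ≠ 0 := fun h => hc (by rw [h] at hW; exact hW)
  have hWpos : 0 < |W| := abs_pos.2 hW0
  have hlow : ∀ᶠ k : ℕ in atTop, |W| / 2 * Real.exp (g * k) ≤ |affinePath p c k| := by
    filter_upwards [hprod, hW.abs.eventually (lt_mem_nhds (half_lt_self hWpos))] with k h1 h2
    have e : affinePath p c k = R k * Q k := (div_mul_cancel₀ _ (hQ0 k)).symm
    rw [e, abs_mul]
    gcongr
  refine ⟨?_, ?_⟩
  · filter_upwards [hlow] with k hk
    have : 0 < |W| / 2 * Real.exp (g * k) := by positivity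
    exact abs_pos.1 (this.trans_le hk)
  · refine Summable.of_norm_bounded_eventually_nat (hY.mul_left (2 / |W|)) ?_
    filter_upwards [hlow] with k hk
    rw [Real.norm_of_nonneg (mul_nonneg (by positivity) (hY0 k)), ← mul_assoc]
    have := hY0 k
    gcongr
    rw [Real.exp_neg, ← inv_div, ← mul_inv]
    exact inv_anti₀ (by positivity) hk

section Explosive

variable {Ω : Type*} [MeasurableSpace Ω] {P : Measure Ω}

/-- The expectation of the series is a convergent geometric series times `E Y_0`; independence plays
no role. -/
lemma ae_summable_exp_mul {Y : ℕ → Ω → ℝ} {g : ℝ} (hg : 0 < g) (hYm : ∀ k, Measurable (Y k))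
    (hY0 : ∀ k a, 0 ≤ Y k a) (hid : ∀ k, IdentDistrib (Y k) (Y 0) P P)
    (hint : Integrable (Y 0) P) :
    ∀ᵐ a ∂P, Summable fun k : ℕ => Real.exp (-(g * k)) * Y k a := by
  have hg1 : Real.exp (-g) < 1 := by simpa using hg
  have e : ∀ k : ℕ, Real.exp (-(g * k)) = Real.exp (-g) ^ k := fun k => by
    rw [← Real.exp_nat_mul]; ring_nf
  have hm : ∀ k : ℕ, Measurable fun a => ENNReal.ofReal (Real.exp (-(g * k)) * Y k a) :=
    fun k => ((hYm k).const_mul _).ennreal_ofReal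
  have hfin : ∫⁻ a, ∑' k : ℕ, ENNReal.ofReal (Real.exp (-(g * k)) * Y k a) ∂P ≠ ⊤ := by
    rw [lintegral_tsum fun k => (hm k).aemeasurable]
    have h1 : ∀ k : ℕ, ∫⁻ a, ENNReal.ofReal (Real.exp (-(g * k)) * Y k a) ∂P =
        ENNReal.ofReal (Real.exp (-g)) ^ k * ∫⁻ a, ENNReal.ofReal (Y 0 a) ∂P := by
      intro k
      have h2 : ∫⁻ a, ENNReal.ofReal (Y k a) ∂P = ∫⁻ a, ENNReal.ofReal (Y 0 a) ∂P :=
        ((hid k).comp ENNReal.measurable_ofReal).lintegral_eq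
      rw [← h2, ← lintegral_const_mul _ (hYm k).ennreal_ofReal]
      refine lintegral_congr fun a => ?_
      rw [ENNReal.ofReal_mul (Real.exp_pos _).le, e, ENNReal.ofReal_pow (Real.exp_pos _).le]
    simp_rw [h1]
    rw [ENNReal.tsum_mul_right, ENNReal.tsum_geometric]
    refine ENNReal.mul_ne_top ?_ hint.lintegral_lt_top.ne
    rw [ENNReal.inv_ne_top, ← pos_iff_ne_zero, tsub_pos_iff_lt]
    simpa using hg1
  filter_upwards [ae_lt_top (Measurable.tsum hm) hfin] with a ha
  have := ENNReal.summable_toReal ha.ne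
  refine this.congr fun k => ENNReal.toReal_ofReal ?_
  exact mul_nonneg (Real.exp_pos _).le (hY0 k a)

variable [IsProbabilityMeasure P]

/-- Explosive random coefficient autoregressions: the path is eventually nonzero and grows so fast
that its reciprocals are summable against the (squared) innovations. -/
theorem ae_summable_inv_abs_rcaPath {b e : ℕ → Ω → ℝ} {φ x₀ : ℝ}
    (hb : ∀ k, Measurable (b k)) (he : ∀ k, Measurable (e k))
    (hindep : iIndepFun (fun k a => (b k a, e k a)) P)
    (hident : ∀ k, IdentDistrib (fun a => (b k a, e k a)) (fun a => (b 0 a, e 0 a)) P P)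
    (hb2 : Integrable (fun a => b 0 a ^ 2) P) (he2 : Integrable (fun a => e 0 a ^ 2) P)
    (hne : ∀ᵐ a ∂P, φ + b 0 a ≠ 0)
    (hlogint : Integrable (fun a => Real.log |φ + b 0 a|) P)
    (hlog : 0 < ∫ a, Real.log |φ + b 0 a| ∂P)
    (hfix : ∀ z : ℝ, ¬ ∀ᵐ a ∂P, (φ + b 0 a) * z + e 0 a = z) :
    ∀ᵐ a ∂P, (∀ᶠ k in atTop, rcaPath φ x₀ (fun k => b k a) (fun k => e k a) k ≠ 0) ∧
      Summable fun k => |rcaPath φ x₀ (fun k => b k a) (fun k => e k a) k|⁻¹ *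
        (1 + b (k + 1) a ^ 2 + e (k + 1) a ^ 2) := by
  set ξ : ℕ → Ω → ℝ × ℝ := fun k a => (φ + b (k + 1) a, e (k + 1) a) with hξ
  have hξm : ∀ k, Measurable (ξ k) := fun k => by fun_prop
  set ν := P.map (fun a => (φ + b 0 a, e 0 a)) with hν
  have hm0 : Measurable fun a => (φ + b 0 a, e 0 a) := by fun_prop
  have hνp : IsProbabilityMeasure ν := Measure.isProbabilityMeasure_map hm0.aemeasurable
  have hu : Measurable fun x : ℝ × ℝ => (φ + x.1, x.2) := by fun_prop
  have hξi : iIndepFun ξ P :=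
    (hindep.precomp (g := fun k : ℕ => k + 1) (add_left_injective 1)).comp
      (fun _ x => (φ + x.1, x.2)) fun _ => hu
  have hξd : ∀ k, IdentDistrib (ξ k) (fun a => (φ + b 0 a, e 0 a)) P P := fun k =>
    (hident (k + 1)).comp hu
  have hlaw : P.map (fun a k => ξ k a) = Measure.infinitePi fun _ : ℕ => ν := by
    rw [hξi.map_fun_eq_infinitePi_map hξm]
    congr 1
    ext1 k
    exact (hξd k).map_eq
  have hnegl : ∀ᵐ a ∂P, (fun k => ξ k a) ∉ negligibleOrbit x₀ := by
    have h := infinitePi_negligibleOrbit ν ?_ ?_ ?_ x₀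
    · rw [← hlaw, Measure.map_apply (measurable_pi_lambda _ hξm)
        (measurableSet_negligibleOrbit_right _)] at h
      exact measure_eq_zero_iff_ae_notMem.1 h
    · exact (ae_map_iff hm0.aemeasurable (by measurability)).2 hne
    · rw [ae_map_iff hm0.aemeasurable (measurableSet_le (by fun_prop) (by fun_prop))]
      intro h
      refine absurd hlog (not_lt.2 (integral_nonpos_of_ae ?_))
      filter_upwards [h] with a ha
      exact Real.log_nonpos (abs_nonneg _) ha
    · intro z h
      rw [ae_map_iff hm0.aemeasurable (measurableSet_eq_fun (by fun_prop) (by fun_prop))] at h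
      exact hfix z h
  -- Not implied by the log-moment: `Real.log 0 = 0` would hide a vanishing coefficient.
  have hnz : ∀ᵐ a ∂P, ∀ k, φ + b (k + 1) a ≠ 0 := by
    refine ae_all_iff.2 fun k => ?_
    have := (hξd k).symm.ae_snd (p := fun x => x.1 ≠ 0) (by measurability) hne
    exact this
  set G := ∫ a, Real.log |φ + b 0 a| ∂P with hG
  have hlogm : Measurable fun x : ℝ × ℝ => Real.log |x.1| := by fun_prop
  have hLd : ∀ k, IdentDistrib (fun a => Real.log |φ + b (k + 1) a|)
      (fun a => Real.log |φ + b 0 a|) P P := fun k => (hξd k).comp hlogm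
  have hslln : ∀ᵐ a ∂P, Tendsto
      (fun n : ℕ => (∑ i ∈ Finset.range n, Real.log |φ + b (i + 1) a|) / n) atTop (𝓝 G) := by
    have := strong_law_ae_real (μ := P) (fun k a => Real.log |φ + b (k + 1) a|)
      ((hLd 0).integrable_iff.2 hlogint)
      (fun i j hij => (hξi.indepFun hij).comp hlogm hlogm)
      (fun k => (hLd k).trans (hLd 0).symm)
    rwa [(hLd 0).integral_eq] at this
  have hYu : Measurable fun x : ℝ × ℝ => 1 + x.1 ^ 2 + x.2 ^ 2 := by fun_prop
  have hYd : ∀ k, IdentDistrib (fun a => 1 + b (k + 1) a ^ 2 + e (k + 1) a ^ 2)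
      (fun a => 1 + b 0 a ^ 2 + e 0 a ^ 2) P P := fun k => (hident (k + 1)).comp hYu
  -- The rate `G / 2` lies strictly below the Lyapunov exponent `G`, so the strong law eventually
  -- gives `|∏ (φ + b)| ≥ exp (n G / 2)`.
  have hsumm := ae_summable_exp_mul (P := P) (g := G / 2)
    (Y := fun k a => 1 + b (k + 1) a ^ 2 + e (k + 1) a ^ 2) (by linarith)
    (fun k => by fun_prop) (fun k a => by positivity) (fun k => (hYd k).trans (hYd 0).symm)
    ((hYd 0).integrable_iff.2 (((integrable_const 1).add hb2).add he2))
  filter_upwards [hnegl, hnz, hslln, hsumm] with a h1 h2 h3 h4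
  simp_rw [rcaPath_eq_affinePath]
  refine summable_inv_abs_affinePath (g := G / 2) h2 (by linarith) ?_ ?_ h4 h1
  · filter_upwards [h3.eventually (lt_mem_nhds (half_lt_self hlog)), eventually_gt_atTop 0]
      with n hn hn0
    have hn' : (0 : ℝ) < n := by exact_mod_cast hn0
    rw [lt_div_iff₀ hn'] at hn
    rw [Finset.abs_prod, ← Real.exp_log (Finset.prod_pos fun k _ => abs_pos.2 (h2 k)),
      Real.log_prod fun k _ => (abs_pos.2 (h2 k)).ne']
    exact Real.exp_le_exp.2 hn.le
  · intro k
    simp only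
    nlinarith [sq_abs (e (k + 1) a), sq_nonneg (|e (k + 1) a| - 1), sq_nonneg (b (k + 1) a)]

end Explosive

/-! ### Central limit theorem for the first two empirical moments -/

section CentralLimit

variable {Ω : Type*} [MeasurableSpace Ω] {P : Measure Ω}

/-- The normalized empirical first and second moments of a centred sample. -/
noncomputable def momentVec (P : Measure Ω) (B : ℕ → Ω → ℝ) (n : ℕ) (a : Ω) :
    EuclideanSpace ℝ (Fin 2) :=
  !₂[(√(n : ℝ))⁻¹ * ∑ k ∈ Finset.range n, B k a,
    (√(n : ℝ))⁻¹ * (∑ k ∈ Finset.range n, B k a ^ 2 - n * ∫ a, B 0 a ^ 2 ∂P)]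

lemma measurable_momentVec {B : ℕ → Ω → ℝ} (hB : ∀ k, Measurable (B k)) (n : ℕ) :
    Measurable (momentVec P B n) := by
  refine (WithLp.measurable_toLp 2 _).comp (measurable_pi_lambda _ fun i => ?_)
  fin_cases i
  · exact (Finset.measurable_sum _ fun k _ => hB k).const_mul _
  · exact ((Finset.measurable_sum _ fun k _ => (hB k).pow_const 2).sub_const _).const_mul _

variable [IsProbabilityMeasure P]

lemma integrable_pow_of_integrable_pow_four {B : Ω → ℝ} (hB : Measurable B)
    (h4 : Integrable (fun a => B a ^ 4) P) {k : ℕ} (hk : k ≤ 4) :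
    Integrable (fun a => B a ^ k) P := by
  refine ((integrable_const 1).add h4).mono' (by fun_prop) (ae_of_all _ fun a => ?_)
  rw [norm_pow, Real.norm_eq_abs]
  have e : B a ^ 4 = |B a| ^ 4 := by rw [← abs_pow, abs_of_nonneg (by positivity)]
  simp only [Pi.add_apply, e]
  rcases le_total |B a| 1 with h | h
  · have := pow_le_one₀ (n := k) (abs_nonneg _) h
    have : 0 ≤ |B a| ^ 4 := by positivity
    linarith
  · have := pow_le_pow_right₀ h hk
    linarith

/-- Gives both positive semidefiniteness of the limit covariance and, via Cramér–Wold, the variance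
of each one-dimensional projection. -/
lemma variance_linear_add_square {B : Ω → ℝ} (hB : Measurable B)
    (h4 : Integrable (fun a => B a ^ 4) P) (h1 : ∫ a, B a ∂P = 0) (x : Fin 2 → ℝ) :
    Var[fun a => x 0 * B a + x 1 * B a ^ 2; P] =
      dotProduct x (Matrix.mulVec (limitCov P B) x) := by
  have hL1 : MemLp B 2 P := (memLp_two_iff_integrable_sq hB.aestronglyMeasurable).2
    (integrable_pow_of_integrable_pow_four hB h4 (by norm_num))
  have hL2 : MemLp (fun a => B a ^ 2) 2 P :=
    (memLp_two_iff_integrable_sq (by fun_prop)).2 (by simpa [← pow_mul] using h4)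
  rw [variance_fun_add (hL1.const_mul _) (hL2.const_mul _), variance_const_mul, variance_const_mul,
    covariance_const_mul_left, covariance_const_mul_right, covariance_eq_sub hL1 hL2, h1,
    variance_of_integral_eq_zero hB.aemeasurable h1]
  have e : ∫ a, (B * fun a => B a ^ 2) a ∂P = ∫ a, B a ^ 3 ∂P := by
    congr 1; ext a; simp only [Pi.mul_apply]; ring
  rw [e]
  simp [limitCov, Matrix.mulVec, dotProduct, Fin.sum_univ_two]
  ring

lemma limitCov_posSemidef {B : Ω → ℝ} (hB : Measurable B)
    (h4 : Integrable (fun a => B a ^ 4) P) (h1 : ∫ a, B a ∂P = 0) :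
    (limitCov P B).PosSemidef := by
  refine Matrix.PosSemidef.of_dotProduct_mulVec_nonneg ?_ fun x => ?_
  · ext i j
    fin_cases i <;> fin_cases j <;> simp [limitCov]
  · rw [star_trivial, ← variance_linear_add_square hB h4 h1]
    exact variance_nonneg _ _

theorem tendstoInDistribution_momentVec {B : ℕ → Ω → ℝ} (hB : ∀ k, Measurable (B k))
    (hindep : iIndepFun B P) (hident : ∀ k, IdentDistrib (B k) (B 0) P P)
    (h4 : Integrable (fun a => B 0 a ^ 4) P) (h1 : ∫ a, B 0 a ∂P = 0) :
    TendstoInDistribution (momentVec P B) atTop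
      (id : EuclideanSpace ℝ (Fin 2) → EuclideanSpace ℝ (Fin 2)) (fun _ => P)
      (multivariateGaussian 0 (limitCov P (B 0))) where
  forall_aemeasurable n := (measurable_momentVec hB n).aemeasurable
  tendsto := by
    refine ProbabilityMeasure.tendsto_iff_tendsto_charFun.2 fun t => ?_
    have hu : Measurable fun x : ℝ => t 0 * x + t 1 * x ^ 2 := by fun_prop
    set Z : ℕ → Ω → ℝ := fun k a => t 0 * B k a + t 1 * B k a ^ 2 with hZ
    have hZd : ∀ k, IdentDistrib (Z k) (Z 0) P P := fun k => (hident k).comp hu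
    have hZi : iIndepFun Z P := hindep.comp (fun _ x => t 0 * x + t 1 * x ^ 2) fun _ => hu
    have hI := fun {k : ℕ} (hk : k ≤ 4) => integrable_pow_of_integrable_pow_four (hB 0) h4 hk
    have hL1 : MemLp (B 0) 2 P := (memLp_two_iff_integrable_sq (hB 0).aestronglyMeasurable).2
      (hI (by norm_num))
    have hL2 : MemLp (fun a => B 0 a ^ 2) 2 P :=
      (memLp_two_iff_integrable_sq (by fun_prop)).2 (by simpa [← pow_mul] using h4)
    have hZL : MemLp (Z 0) 2 P := (hL1.const_mul _).add (hL2.const_mul _)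
    have hEZ : ∫ a, Z 0 a ∂P = t 1 * ∫ a, B 0 a ^ 2 ∂P := by
      simp only [hZ]
      rw [integral_add ((hL1.integrable one_le_two).const_mul _)
        ((hL2.integrable one_le_two).const_mul _), integral_const_mul, integral_const_mul, h1]
      simp
    have hclt := (tendstoInDistribution_inv_sqrt_mul_sum_sub (Y := id)
      (P' := gaussianReal 0 Var[Z 0; P].toNNReal) HasLaw.id hZL hZi hZd).tendsto
    -- The characteristic function of the vector at `t` is that of the normalized sum of `t 0 * B +
    -- t 1 * B²` at 1.
    have hchar := ProbabilityMeasure.tendsto_iff_tendsto_charFun.1 hclt 1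
    have hm : ∀ n : ℕ, Measurable fun a =>
        (√(n : ℝ))⁻¹ * (∑ k ∈ Finset.range n, Z k a - n * ∫ a, Z 0 a ∂P) := fun n =>
      ((Finset.measurable_sum _ fun k _ => hu.comp (hB k)).sub_const _).const_mul _
    simp only [ProbabilityMeasure.coe_mk, Measure.map_id, charFun_gaussianReal] at hchar ⊢
    rw [charFun_multivariateGaussian (limitCov_posSemidef (hB 0) h4 h1),
      ← variance_linear_add_square (hB 0) h4 h1]
    convert! hchar using 1
    · ext n
      rw [charFun_apply, charFun_apply,
        integral_map (measurable_momentVec hB n).aemeasurable (by fun_prop),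
        integral_map (hm n).aemeasurable (by fun_prop)]
      refine integral_congr_ae (ae_of_all _ fun a => ?_)
      simp only
      congr 3
      rw [hEZ]
      simp only [momentVec, PiLp.inner_apply, Fin.sum_univ_two, hZ, Finset.sum_add_distrib,
        ← Finset.mul_sum]
      simp
      ring
    · congr 2
      rw [Real.coe_toNNReal _ (variance_nonneg _ _)]
      simp
      rfl

end CentralLimit

/-! ### Transfer of the limit law to the estimator -/

lemma euclidean_norm_le_abs_add_abs (x : EuclideanSpace ℝ (Fin 2)) : ‖x‖ ≤ |x 0| + |x 1| := by
  rw [EuclideanSpace.norm_eq, Fin.sum_univ_two]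
  refine Real.sqrt_le_iff.2 ⟨by positivity, ?_⟩
  simp only [Real.norm_eq_abs]
  nlinarith [abs_nonneg (x 0), abs_nonneg (x 1)]

/-- Normalized distance between the estimator and the corrected empirical moments. -/
lemma tendsto_sqrt_smul_sub {z W : ℕ → EuclideanSpace ℝ (Fin 2)} {m w : ℕ → ℝ} {φ v C : ℝ}
    (h : ∀ᶠ n : ℕ in atTop, |z n 0 - m n| + |z n 1 - w n| ≤ C / n)
    (hW : ∀ᶠ n : ℕ in atTop, W n = √(n : ℝ) • (!₂[m n, w n] - !₂[φ, v])) :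
    Tendsto (fun n : ℕ => √(n : ℝ) • (z n - !₂[φ, v]) - W n) atTop (𝓝 0) := by
  have hlim : Tendsto (fun n : ℕ => C / √(n : ℝ)) atTop (𝓝 0) :=
    tendsto_const_nhds.div_atTop (Real.tendsto_sqrt_atTop.comp tendsto_natCast_atTop_atTop)
  refine squeeze_zero_norm' ?_ hlim
  filter_upwards [h, hW, eventually_gt_atTop 0] with n h1 h2 hn
  have hn' : (0 : ℝ) < n := by exact_mod_cast hn
  rw [h2, ← smul_sub, sub_sub_sub_cancel_right, norm_smul, Real.norm_of_nonneg (Real.sqrt_nonneg _)]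
  have h3 : ‖z n - !₂[m n, w n]‖ ≤ C / n :=
    (euclidean_norm_le_abs_add_abs _).trans (by simpa using h1)
  calc √(n : ℝ) * ‖z n - !₂[m n, w n]‖ ≤ √(n : ℝ) * (C / n) := by gcongr
    _ = C / √(n : ℝ) := by
      have := Real.sqrt_pos.2 hn'
      nth_rw 2 [← Real.sq_sqrt hn'.le]
      field_simp

/-- Uncorrelated, centred coefficients with a nondegenerate additive part have no almost sure fixed
point; this replaces any further nondegeneracy condition on the innovations. -/
lemma not_ae_common_fixed_point {Ω : Type*} [MeasurableSpace Ω] {P : Measure Ω}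
    [IsProbabilityMeasure P] {B E : Ω → ℝ} {φ : ℝ} (hB : MemLp B 2 P) (hE : MemLp E 2 P)
    (hB1 : ∫ a, B a ∂P = 0) (hE1 : ∫ a, E a ∂P = 0) (hE2 : 0 < ∫ a, E a ^ 2 ∂P)
    (hcov : covariance B E P = 0) (z : ℝ) : ¬ ∀ᵐ a ∂P, (φ + B a) * z + E a = z := by
  intro h
  have hBE : ∫ a, B a * E a ∂P = 0 := by
    rw [covariance_eq_sub hB hE, hB1] at hcov
    simpa using hcov
  have hint : Integrable (fun a => B a * E a) P := hB.integrable_mul hE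
  -- Multiply the fixed-point equation by `E` and integrate: every term on the right has mean zero.
  have e : ∫ a, E a ^ 2 ∂P = ∫ a, (z * (1 - φ)) * E a - z * (B a * E a) ∂P := by
    refine integral_congr_ae ?_
    filter_upwards [h] with a ha
    linear_combination E a * ha
  rw [integral_sub ((hE.integrable one_le_two).const_mul _) (hint.const_mul _),
    integral_const_mul, integral_const_mul, hBE, hE1] at e
  rw [e] at hE2
  simp at hE2

theorem corollary3p2 {Ω : Type*} [MeasurableSpace Ω] (P : Measure Ω) [IsProbabilityMeasure P]
    (b e : ℕ → Ω → ℝ) (φ ω σ x₀ sLo sHi xLo xHi : ℝ)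
    -- the pairs `(b_k, e_k)` are i.i.d. random vectors
    (hb : ∀ k, Measurable (b k)) (he : ∀ k, Measurable (e k))
    (hindep : iIndepFun (fun k a => (b k a, e k a)) P)
    (hident : ∀ k, IdentDistrib (fun a => (b k a, e k a)) (fun a => (b 0 a, e 0 a)) P P)
    -- moments
    (hb4 : Integrable (fun a => b 0 a ^ 4) P) (he4 : Integrable (fun a => e 0 a ^ 4) P)
    (hb1 : ∫ a, b 0 a ∂P = 0) (hb2 : ∫ a, b 0 a ^ 2 ∂P = ω ^ 2) (hω : 0 < ω ^ 2)
    (he1 : ∫ a, e 0 a ∂P = 0) (he2 : ∫ a, e 0 a ^ 2 ∂P = σ ^ 2) (hσ : 0 < σ ^ 2)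
    (hcov : covariance (b 0) (e 0) P = 0)
    -- `E log |φ + b_0| > 0`, where `log 0 = -∞`
    (hne : ∀ᵐ a ∂P, φ + b 0 a ≠ 0)
    (hlogint : Integrable (fun a => Real.log |φ + b 0 a|) P)
    (hlog : 0 < ∫ a, Real.log |φ + b 0 a| ∂P)
    -- one of the two nondegeneracy conditions
    (hnondeg : (∀ c : ℝ, P {a | (φ + b 0 a) * x₀ + e 0 a = c} = 0) ∨
      (IndepFun (fun a k => b k a) (fun a k => e k a) P ∧ ∀ c : ℝ, P {a | e 0 a = c} < 1))
    -- the parameter rectangle has `(φ, ω²)` in its interior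
    (hx : 0 < xLo) (hφ : sLo < φ ∧ φ < sHi) (hω2 : xLo < ω ^ 2 ∧ ω ^ 2 < xHi) :
    (limitCov P (b 0)).PosSemidef ∧
    ∀ y : ℝ, 0 < y → ∀ η : ℕ → Ω → EuclideanSpace ℝ (Fin 2),
      (∀ n, Measurable (η n)) →
      (∀ n, ∀ᵐ a ∂P, IsQMLE (rcaPath φ x₀ (fun k => b k a) (fun k => e k a)) n y
        (paramRect sLo sHi xLo xHi) (η n a)) →
      TendstoInDistribution
        (fun (n : ℕ) a => √(n : ℝ) • (η n a - !₂[φ, ω ^ 2])) atTop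
        (id : EuclideanSpace ℝ (Fin 2) → EuclideanSpace ℝ (Fin 2)) (fun _ => P)
        (multivariateGaussian 0 (limitCov P (b 0))) := by
  refine ⟨limitCov_posSemidef (hb 0) hb4 hb1, fun y hy η hη hQ => ?_⟩
  have hb2i := integrable_pow_of_integrable_pow_four (hb 0) hb4 (k := 2) (by norm_num)
  have he2i := integrable_pow_of_integrable_pow_four (he 0) he4 (k := 2) (by norm_num)
  have hbL := (memLp_two_iff_integrable_sq (hb 0).aestronglyMeasurable).2 hb2i
  have heL := (memLp_two_iff_integrable_sq (he 0).aestronglyMeasurable).2 he2i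
  have hgrow := ae_summable_inv_abs_rcaPath (x₀ := x₀) hb he hindep hident hb2i he2i hne hlogint
    hlog (not_ae_common_fixed_point hbL heL hb1 he1 (he2 ▸ hσ) hcov)
  -- The path starts using the coefficients at index 1, hence the shift.
  set B : ℕ → Ω → ℝ := fun k => b (k + 1) with hB
  have hBm : ∀ k, Measurable (B k) := fun k => hb (k + 1)
  have hBd0 : ∀ k, IdentDistrib (B k) (b 0) P P := fun k =>
    (hident (k + 1)).comp measurable_fst
  have hBd : ∀ k, IdentDistrib (B k) (B 0) P P := fun k => (hBd0 k).trans (hBd0 0).symm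
  have hBi : iIndepFun B P :=
    (hindep.precomp (g := fun k : ℕ => k + 1) (add_left_injective 1)).comp
      (fun _ x => x.1) fun _ => measurable_fst
  have hpow : ∀ k : ℕ, IdentDistrib (fun a => B 0 a ^ k) (fun a => b 0 a ^ k) P P := fun k =>
    (hBd0 0).comp (measurable_id.pow_const k)
  have hB1 : ∫ a, B 0 a ∂P = 0 := by rw [(hBd0 0).integral_eq, hb1]
  have hB2 : ∫ a, B 0 a ^ 2 ∂P = ω ^ 2 := by rw [(hpow 2).integral_eq, hb2]
  have hB4 : Integrable (fun a => B 0 a ^ 4) P := (hpow 4).integrable_iff.2 hb4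
  have hcovB : limitCov P (B 0) = limitCov P (b 0) := by
    simp only [limitCov, (hpow 2).integral_eq, (hpow 3).integral_eq, (hpow 2).variance_eq]
  have hclt := tendstoInDistribution_momentVec hBm hBi hBd hB4 hB1
  rw [hcovB] at hclt
  have hmean : ∀ᵐ a ∂P, Tendsto (fun n : ℕ => (∑ k ∈ Finset.range n, B k a) / n) atTop (𝓝 0) := by
    have := strong_law_ae_real B ((hBd0 0).integrable_iff.2 (hbL.integrable one_le_two))
      (fun i j hij => hBi.indepFun hij) hBd
    rwa [hB1] at this
  have hsq : ∀ᵐ a ∂P,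
      Tendsto (fun n : ℕ => (∑ k ∈ Finset.range n, B k a ^ 2) / n) atTop (𝓝 (ω ^ 2)) := by
    have hu : Measurable fun x : ℝ => x ^ 2 := by fun_prop
    have := strong_law_ae_real (μ := P) (fun k a => B k a ^ 2) ((hpow 2).integrable_iff.2 hb2i)
      (fun i j hij => (hBi.indepFun hij).comp hu hu) (fun k => (hBd k).comp hu)
    rwa [hB2] at this
  set M : ℕ → Ω → ℝ := fun n a => (∑ k ∈ Finset.range n, B k a) / n with hM
  have hMm : ∀ n, Measurable (M n) := fun n =>
    (Finset.measurable_sum _ fun k _ => hBm k).div_const _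
  -- replacing the second empirical moment by the empirical variance does not change the limit
  have hclt' : TendstoInDistribution
      (fun (n : ℕ) a => momentVec P B n a - !₂[0, momentVec P B n a 0 * M n a]) atTop
      (id : EuclideanSpace ℝ (Fin 2) → EuclideanSpace ℝ (Fin 2)) (fun _ => P)
      (multivariateGaussian 0 (limitCov P (b 0))) := by
    -- Slutsky: the correction `√n M²` is the first coordinate `√n M`, convergent in law, times `M →
    -- 0`.
    have h := hclt.continuous_comp_prodMk_of_tendstoInMeasure_const
      (g := fun x : EuclideanSpace ℝ (Fin 2) × ℝ =>
        x.1 - (!₂[0, x.1 0 * x.2] : EuclideanSpace ℝ (Fin 2))) (c := (0 : ℝ)) (Y := M)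
      ?_ (tendstoInMeasure_of_tendsto_ae (fun n => (hMm n).aestronglyMeasurable) hmean)
      (fun n => (hMm n).aemeasurable)
    · refine h.congr (fun n => ae_of_all _ fun a => rfl) (ae_of_all _ fun x => ?_)
      ext i
      fin_cases i <;> simp
    · refine continuous_fst.sub ((PiLp.continuous_toLp 2 _).comp (continuous_pi fun i => ?_))
      fin_cases i
      · exact continuous_const
      · simp only [Fin.mk_one, Matrix.cons_val_one]
        fun_prop
  have hηm : ∀ n : ℕ, AEMeasurable (fun a => √(n : ℝ) • (η n a - !₂[φ, ω ^ 2])) P := fun n =>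
    (((hη n).sub_const !₂[φ, ω ^ 2]).const_smul √(n : ℝ)).aemeasurable
  refine tendstoInDistribution_of_tendstoInMeasure_sub _ _ hclt' ?_
    hηm
  refine tendstoInMeasure_of_tendsto_ae (fun n => ?_) ?_
  · exact ((hηm n).sub (hclt'.forall_aemeasurable n)).aestronglyMeasurable
  filter_upwards [hgrow, hmean, hsq, ae_all_iff.2 hQ] with a hga hma hsa hqa
  obtain ⟨C, hC⟩ := exists_isQMLE_close (sLo := sLo) (sHi := sHi) (xHi := xHi)
    (X := rcaPath φ x₀ (fun k => b k a) (fun k => e k a)) (β := fun k => b (k + 1) a)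
    (ε := fun k => e (k + 1) a) (φ := φ) hx hy (fun k => rfl) hga.1 hga.2
  set w : ℕ → ℝ := fun n => (∑ k ∈ Finset.range n, B k a ^ 2) / n - M n a ^ 2 with hw
  have hwlim : Tendsto w atTop (𝓝 (ω ^ 2)) := by
    simpa using hsa.sub (hma.pow 2)
  have hmlim : Tendsto (fun n => φ + M n a) atTop (𝓝 φ) := by
    simpa using tendsto_const_nhds.add hma
  refine tendsto_sqrt_smul_sub (m := fun n => φ + M n a) (w := w) (C := C) ?_ ?_
  -- As `(φ, ω²)` is interior, the strong law eventually puts the empirical mean and variance inside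
  -- the rectangle, making them admissible competitors.
  · filter_upwards [eventually_gt_atTop 0, hmlim.eventually (Icc_mem_nhds hφ.1 hφ.2),
      hwlim.eventually (Icc_mem_nhds hω2.1 hω2.2)] with n hn h1 h2
    have hn' : (n : ℝ) ≠ 0 := by exact_mod_cast hn.ne'
    refine hC n (η n a) _ _ hn ?_ ?_ h1 h2 (hqa n)
    · rw [Finset.sum_add_distrib, Finset.sum_const, Finset.card_range, nsmul_eq_mul, mul_add]
      congr 1
      exact mul_div_cancel₀ _ hn'
    · have e1 : ∀ k, (φ + B k a) ^ 2 = φ ^ 2 + (2 * φ * B k a + B k a ^ 2) := fun k => by ring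
      have e2 : (∑ k ∈ Finset.range n, B k a) = n * M n a := (mul_div_cancel₀ _ hn').symm
      change _ = ∑ k ∈ Finset.range n, (φ + B k a) ^ 2
      simp_rw [e1]
      rw [Finset.sum_add_distrib, Finset.sum_add_distrib, ← Finset.mul_sum, e2, Finset.sum_const,
        Finset.card_range, nsmul_eq_mul]
      simp only [hw]
      field_simp
      ring
  · filter_upwards [eventually_gt_atTop 0] with n hn
    have hn' : (0 : ℝ) < n := by exact_mod_cast hn
    have hs := Real.sqrt_pos.2 hn'
    have hs2 := Real.sq_sqrt hn'.le
    have e2 : (∑ k ∈ Finset.range n, B k a) = n * M n a := (mul_div_cancel₀ _ hn'.ne').symm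
    have e3 : (∑ k ∈ Finset.range n, B k a ^ 2) = n * (w n + M n a ^ 2) := by
      simp only [hw]; field_simp; ring
    have e4 : (√(n : ℝ))⁻¹ * n = √(n : ℝ) := by
      nth_rw 2 [← hs2]; field_simp
    ext i
    fin_cases i
    · simp [momentVec, e2]
      rw [← mul_assoc, e4]
    · simp [momentVec, e2, e3, hB2]
      linear_combination (w n - ω ^ 2) * e4
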